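/- Let $k$ be a perfect field of characteristic $p>0$. A $k$-variety is an integral separated scheme of finite type over $k$. Let $X$ and $Z$ be normal $k$-varieties and let $g\colon X\to Z$ be a finite surjective morphism of schemes, not necessarily over $k$, that is purely inseparable of height one: the extension $k(Z)\subseteq k(X)$ of function fields is purely inseparable, and there is a morphism of schemes $h\colon Z\to X$ such that $h\circ g=F_X$, where $F_X$ is the absolute Frobenius of $X$ (the identity on points and $s\mapsto s^p$ on functions). For a Cartier divisor $L$ on a $k$-variety $Y$, let $\mathrm{Bs}(L)$ be the base locus of the complete linear system $|L|$, that is, the intersection of the supports of all effective Cartier divisors linearly equivalent to $L$ (all of $Y$ if there are none). Put $\mathbf B(L)=\bigl(\bigcap_{m\ge 1}\mathrm{Bs}(mL)\bigr)_{\mathrm{red}}$. For a $\mathbb Q$-divisor $D\in \mathrm{Div}(Y)\otimes_{\mathbb Z}\mathbb Q$, where $\mathrm{Div}(Y)$ is the group of Cartier divisors, put $\mathbf B(D)=\mathbf B(bD)$ for any integer $b\ge 1$ such that $bD$ is Cartier; this does not depend on $b$. Then for every $\mathbb Q$-divisor $D$ on $Z$, $$\mathbf B(g^*D)=g^{-1}\mathbf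 B(D)$$ as reduced closed subschemes of $X$, where $g^{-1}\mathbf B(D)$ is the reduced scheme associated to the scheme-theoretic preimage of $\mathbf B(D)$ under $g$. -/

import Mathlib

open CategoryTheory AlgebraicGeometry TopologicalSpace
open scoped TensorProduct

universe u

noncomputable section

namespace StableBase

/-! ### Function fields and dominant morphisms -/

/-- A scheme is normal if all its local rings are integrally closed domains; it is used
here for integral schemes, where the local rings are domains. -/
def IsNormalScheme (X : Scheme.{u}) : Prop :=
  ∀ x : X, IsIntegrallyClosed (X.presheaf.stalk x)

lemma map_genericPoint_specializes {X Z : Scheme.{u}} [IsIntegral X] [IsIntegral Z]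
    (g : X ⟶ Z) [IsDominant g] : g (genericPoint X) ⤳ genericPoint Z := by
  have h := (genericPoint_spec X).image g.continuous
  have h2 : closure (g '' (Set.univ : Set X)) = Set.univ := by
    rw [Set.image_univ]; exact g.denseRange.closure_range
  rw [h2] at h
  exact h.specializes trivial

/-- The homomorphism of function fields `k(Z) → k(X)` induced by a dominant morphism
`g : X ⟶ Z` of integral schemes. -/
def functionFieldMap {X Z : Scheme.{u}} [IsIntegral X] [IsIntegral Z]
    (g : X ⟶ Z) [IsDominant g] : Z.functionField →+* X.functionField :=
  (Z.presheaf.stalkSpecializes (map_genericPoint_specializes g) ≫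
    g.stalkMap (genericPoint X)).hom

lemma functionFieldMap_algebraMap {X Z : Scheme.{u}} [IsIntegral X] [IsIntegral Z]
    (g : X ⟶ Z) [IsDominant g] (x : X) (a : Z.presheaf.stalk (g x)) :
    functionFieldMap g (algebraMap (Z.presheaf.stalk (g x)) Z.functionField a) =
      algebraMap (X.presheaf.stalk x) X.functionField (g.stalkMap x a) := by
  have h := g.stalkSpecializes_stalkMap_apply (genericPoint X) x (genericPoint_specializes x) a
  have h2 : ∀ b, (Z.presheaf.stalkSpecializes (map_genericPoint_specializes g))
      ((Z.presheaf.stalkSpecializes (genericPoint_specializes (g x))) b) =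
      Z.presheaf.stalkSpecializes (g.base.hom.map_specializes (genericPoint_specializes x)) b := by
    intro b
    rw [← CommRingCat.comp_apply, TopCat.Presheaf.stalkSpecializes_comp]
  refine Eq.trans ?_ h
  exact congrArg (g.stalkMap (genericPoint X)) (h2 a)

/-! ### Cartier divisors on integral schemes -/

/-- The units of `𝒪_{X, x}` as a subgroup of the units of the function field. -/
def stalkUnits (X : Scheme.{u}) [IsIntegral X] (x : X) : Subgroup (X.functionField)ˣ :=
  (Units.map (algebraMap (X.presheaf.stalk x) X.functionField).toMonoidHom).range

/-- `k(X)ˣ / 𝒪_{X, x}ˣ`, written additively: the stalk at `x` of the sheaf `𝒦ˣ / 𝒪ˣ`. -/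
def CartierStalk (X : Scheme.{u}) [IsIntegral X] (x : X) : Type u :=
  Additive ((X.functionField)ˣ ⧸ stalkUnits X x)

instance (X : Scheme.{u}) [IsIntegral X] (x : X) : AddCommGroup (CartierStalk X x) :=
  inferInstanceAs (AddCommGroup (Additive ((X.functionField)ˣ ⧸ stalkUnits X x)))

/-- The class of a nonzero rational function in the stalk at `x` of `𝒦ˣ / 𝒪ˣ`. -/
def localClass {X : Scheme.{u}} [IsIntegral X] (x : X) (f : (X.functionField)ˣ) :
    CartierStalk X x :=
  Additive.ofMul (QuotientGroup.mk f)

lemma localClass_mul {X : Scheme.{u}} [IsIntegral X] (x : X) (f f' : (X.functionField)ˣ) :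
    localClass x (f * f') = localClass x f + localClass x f' := rfl

lemma localClass_inv {X : Scheme.{u}} [IsIntegral X] (x : X) (f : (X.functionField)ˣ) :
    localClass x f⁻¹ = - localClass x f := rfl

lemma localClass_one {X : Scheme.{u}} [IsIntegral X] (x : X) :
    localClass x (1 : (X.functionField)ˣ) = 0 := rfl

/-- The group `Div(X)` of Cartier divisors on an integral scheme: the global sections of
the quotient sheaf `𝒦ˣ / 𝒪ˣ`, where `𝒦` is the constant sheaf `k(X)`. Such a section is a
family of germs that is locally given by one rational function (a local equation). -/
def CartierDivisor (X : Scheme.{u}) [IsIntegral X] : AddSubgroup (∀ x : X, CartierStalk X x) where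
  carrier := {D | ∀ x : X, ∃ U : X.Opens, x ∈ U ∧
    ∃ f : (X.functionField)ˣ, ∀ y ∈ U, D y = localClass y f}
  zero_mem' := fun x => ⟨⊤, trivial, 1, fun y _ => (localClass_one y).symm⟩
  add_mem' := by
    intro D E hD hE x
    obtain ⟨U, hU, f, hf⟩ := hD x
    obtain ⟨V, hV, e, he⟩ := hE x
    refine ⟨U ⊓ V, ⟨hU, hV⟩, f * e, fun y hy => ?_⟩
    rw [localClass_mul, ← hf y hy.1, ← he y hy.2]; rfl
  neg_mem' := by
    intro D hD x
    obtain ⟨U, hU, f, hf⟩ := hD x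
    refine ⟨U, hU, f⁻¹, fun y hy => ?_⟩
    rw [localClass_inv, ← hf y hy]; rfl

/-- The principal Cartier divisor of a nonzero rational function. -/
def principal {X : Scheme.{u}} [IsIntegral X] (f : (X.functionField)ˣ) : CartierDivisor X :=
  ⟨fun x => localClass x f, fun _ => ⟨⊤, trivial, f, fun _ _ => rfl⟩⟩

/-- Linear equivalence of Cartier divisors. -/
def LinEquiv {X : Scheme.{u}} [IsIntegral X] (D E : CartierDivisor X) : Prop :=
  ∃ f : (X.functionField)ˣ, D - E = principal f

/-- A Cartier divisor is effective if its local equations are regular functions. -/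
def IsEffective {X : Scheme.{u}} [IsIntegral X] (D : CartierDivisor X) : Prop :=
  ∀ (x : X) (f : (X.functionField)ˣ), D.1 x = localClass x f →
    (f : X.functionField) ∈ (algebraMap (X.presheaf.stalk x) X.functionField).range

lemma mem_stalkUnits_nhds {X : Scheme.{u}} [IsIntegral X] (x : X) (f : (X.functionField)ˣ)
    (hf : f ∈ stalkUnits X x) : ∃ U : X.Opens, x ∈ U ∧ ∀ y ∈ U, f ∈ stalkUnits X y := by
  obtain ⟨a, rfl⟩ := hf
  obtain ⟨V, hxV, s, hs⟩ := X.presheaf.exists_germ_eq (a : X.presheaf.stalk x)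
  have hx : x ∈ X.basicOpen s := by
    rw [Scheme.mem_basicOpen X s x hxV, hs]; exact a.isUnit
  refine ⟨X.basicOpen s, hx, fun y hy => ?_⟩
  have hyV : y ∈ V := X.basicOpen_le s hy
  have hu : IsUnit (X.presheaf.germ V y hyV s) := (Scheme.mem_basicOpen X s y hyV).mp hy
  refine ⟨hu.unit, Units.ext ?_⟩
  have : Nonempty V := ⟨⟨x, hxV⟩⟩
  change algebraMap (X.presheaf.stalk y) X.functionField (X.presheaf.germ V y hyV s) =
    algebraMap (X.presheaf.stalk x) X.functionField (a : X.presheaf.stalk x)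
  rw [← hs, Scheme.algebraMap_germ_eq_germToFunctionField,
    Scheme.algebraMap_germ_eq_germToFunctionField]

/-- The support of a Cartier divisor: the closed set of points at which a local equation
is not a unit of the local ring. -/
def support {X : Scheme.{u}} [IsIntegral X] (D : CartierDivisor X) : Closeds X where
  carrier := {x | D.1 x ≠ 0}
  isClosed' := by
    rw [← isOpen_compl_iff, isOpen_iff_mem_nhds]
    intro x hx
    have hx : D.1 x = 0 := not_not.mp hx
    obtain ⟨U, hxU, f, hf⟩ := D.2 x
    have key : ∀ y, localClass y f = 0 ↔ f ∈ stalkUnits X y := fun y =>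
      QuotientGroup.eq_one_iff f
    obtain ⟨V, hxV, hV⟩ := mem_stalkUnits_nhds x f ((key x).mp (by rw [← hf x hxU, hx]))
    refine Filter.mem_of_superset ((U ⊓ V).isOpen.mem_nhds ⟨hxU, hxV⟩) fun y hy => ?_
    exact not_not.mpr ((hf y hy.1).trans ((key y).mpr (hV y hy.2)))

/-! ### Base loci -/

/-- The complete linear system `|L|`: the effective Cartier divisors linearly equivalent
to `L`. -/
def linearSystem {X : Scheme.{u}} [IsIntegral X] (L : CartierDivisor X) :
    Set (CartierDivisor X) :=
  {E | IsEffective E ∧ LinEquiv E L}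

/-- The base locus of `|L|`, the common support of its members (all of `X` if `|L|` is
empty). -/
def baseLocus {X : Scheme.{u}} [IsIntegral X] (L : CartierDivisor X) : Closeds X :=
  ⨅ E ∈ linearSystem L, support E

/-- The closed set underlying the stable base locus of a Cartier divisor. -/
def cartierStableLocus {X : Scheme.{u}} [IsIntegral X] (L : CartierDivisor X) : Closeds X :=
  ⨅ m : ℕ+, baseLocus ((m : ℕ) • L)

/-- The group of `ℚ`-divisors `Div(X) ⊗ ℚ`. -/
abbrev QDivisor (X : Scheme.{u}) [IsIntegral X] : Type u := ℚ ⊗[ℤ] CartierDivisor X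

/-- The `ℚ`-divisor of a Cartier divisor. -/
def toQDivisor {X : Scheme.{u}} [IsIntegral X] (L : CartierDivisor X) : QDivisor X :=
  (1 : ℚ) ⊗ₜ[ℤ] L

/-- The closed set underlying the stable base locus of a `ℚ`-divisor `D`, namely that of
the Cartier divisor `bD`, for any positive integer `b` such that `bD` is Cartier. The
intersection runs over all choices of `b` and of a Cartier divisor representing `bD`; the
choices exist and all give the same set, see `stableLocus_eq`. -/
def stableLocus {X : Scheme.{u}} [IsIntegral X] (D : QDivisor X) : Closeds X :=
  ⨅ (b : ℕ+) (L : CartierDivisor X) (_ : (b : ℕ) • D = toQDivisor L), cartierStableLocus L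

/-- The stable base locus `𝐁(D)` of a `ℚ`-divisor as a reduced closed subscheme, given by
its ideal sheaf. -/
def stableBaseLocus {X : Scheme.{u}} [IsIntegral X] (D : QDivisor X) : X.IdealSheafData :=
  Scheme.IdealSheafData.vanishingIdeal (stableLocus D)

/-- The reduced closed subscheme associated to the scheme-theoretic preimage of a closed
subscheme, given by ideal sheaves. -/
def reducedPreimage {X Z : Scheme.{u}} (g : X ⟶ Z) (I : Z.IdealSheafData) :
    X.IdealSheafData :=
  (I.comap g).radical

/-! ### Independence of the choices -/

lemma isEffective_nsmul {X : Scheme.{u}} [IsIntegral X] {E : CartierDivisor X}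
    (hE : IsEffective E) (n : ℕ) : IsEffective (n • E) := by
  intro x f hf
  obtain ⟨U, hxU, e, he⟩ := E.2 x
  obtain ⟨a, ha⟩ := hE x e (he x hxU)
  have h1 : localClass x f = localClass x (e ^ n) := by
    rw [← hf]
    change n • E.1 x = _
    rw [he x hxU]; rfl
  have h2 : (e ^ n)⁻¹ * f ∈ stalkUnits X x := QuotientGroup.eq.mp h1.symm
  obtain ⟨v, hv⟩ := h2
  refine ⟨a ^ n * v, ?_⟩
  have h3 : f = e ^ n * Units.map (algebraMap (X.presheaf.stalk x) X.functionField).toMonoidHom v := by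
    rw [hv]; simp
  rw [h3, map_mul, map_pow, ha]
  simp

lemma linEquiv_nsmul {X : Scheme.{u}} [IsIntegral X] {D E : CartierDivisor X}
    (h : LinEquiv D E) (n : ℕ) : LinEquiv (n • D) (n • E) := by
  obtain ⟨f, hf⟩ := h
  refine ⟨f ^ n, ?_⟩
  rw [← nsmul_sub, hf]
  rfl

lemma baseLocus_nsmul_le {X : Scheme.{u}} [IsIntegral X] (L : CartierDivisor X) (n : ℕ) :
    baseLocus (n • L) ≤ baseLocus L := by
  refine le_iInf₂ fun E hE => ?_
  refine (iInf₂_le (n • E) ⟨isEffective_nsmul hE.1 n, linEquiv_nsmul hE.2 n⟩).trans ?_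
  intro x hx h0
  refine hx ?_
  change n • E.1 x = 0
  rw [h0, nsmul_zero]

lemma cartierStableLocus_nsmul {X : Scheme.{u}} [IsIntegral X] (L : CartierDivisor X) (n : ℕ+) :
    cartierStableLocus ((n : ℕ) • L) = cartierStableLocus L := by
  apply le_antisymm
  · refine le_iInf fun m => (iInf_le _ m).trans ?_
    rw [smul_comm]
    exact baseLocus_nsmul_le _ _
  · refine le_iInf fun m => (iInf_le _ (m * n)).trans ?_
    rw [smul_smul, PNat.mul_coe]

lemma exists_cartier_multiple {X : Scheme.{u}} [IsIntegral X] (D : QDivisor X) :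
    ∃ (b : ℕ+) (L : CartierDivisor X), (b : ℕ) • D = toQDivisor L := by
  induction D using TensorProduct.induction_on with
  | zero => exact ⟨1, 0, by simp [toQDivisor]⟩
  | tmul q L =>
    refine ⟨⟨q.den, q.den_pos⟩, q.num • L, ?_⟩
    change q.den • (q ⊗ₜ[ℤ] L) = (1 : ℚ) ⊗ₜ[ℤ] (q.num • L)
    rw [TensorProduct.tmul_smul, TensorProduct.smul_tmul', TensorProduct.smul_tmul']
    congr 1
    simp [Rat.den_mul_eq_num]
  | add D E hD hE =>
    obtain ⟨b, L, h⟩ := hD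
    obtain ⟨c, M, h'⟩ := hE
    refine ⟨b * c, (c : ℕ) • L + (b : ℕ) • M, ?_⟩
    have e : ∀ (n : ℕ) (A : CartierDivisor X), toQDivisor (n • A) = n • toQDivisor A :=
      fun n A => map_nsmul (TensorProduct.mk ℤ ℚ (CartierDivisor X) 1) n A
    have e' : ∀ A B : CartierDivisor X, toQDivisor (A + B) = toQDivisor A + toQDivisor B :=
      fun A B => TensorProduct.tmul_add _ _ _
    rw [e', e, e, ← h, ← h', smul_add, PNat.mul_coe, smul_smul, smul_smul, mul_comm (c : ℕ)]

lemma toQDivisor_eq_zero {X : Scheme.{u}} [IsIntegral X] {L : CartierDivisor X}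
    (h : toQDivisor L = 0) : ∃ n : ℕ+, (n : ℕ) • L = 0 := by
  have : IsLocalizedModule (nonZeroDivisors ℤ) (TensorProduct.mk ℤ ℚ (CartierDivisor X) 1) :=
    (isLocalizedModule_iff_isBaseChange (nonZeroDivisors ℤ) ℚ _).mpr
      (TensorProduct.isBaseChange ℤ (CartierDivisor X) ℚ)
  obtain ⟨c, hc⟩ := (IsLocalizedModule.eq_zero_iff (nonZeroDivisors ℤ)
    (TensorProduct.mk ℤ ℚ (CartierDivisor X) 1)).mp h
  have hc0 : (c : ℤ) ≠ 0 := nonZeroDivisors.ne_zero c.2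
  refine ⟨⟨(c : ℤ).natAbs, Int.natAbs_pos.mpr hc0⟩, ?_⟩
  have hc' : (c : ℤ) • L = 0 := hc
  change (c : ℤ).natAbs • L = 0
  rw [← natCast_zsmul]
  rcases Int.natAbs_eq (c : ℤ) with h1 | h1
  · rw [← h1, hc']
  · rw [h1, neg_smul, neg_eq_zero] at hc'; exact hc'

lemma cartierStableLocus_congr {X : Scheme.{u}} [IsIntegral X] {D : QDivisor X} {b c : ℕ+}
    {L M : CartierDivisor X} (hL : (b : ℕ) • D = toQDivisor L)
    (hM : (c : ℕ) • D = toQDivisor M) : cartierStableLocus L = cartierStableLocus M := by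
  have h : toQDivisor ((c : ℕ) • L - (b : ℕ) • M) = 0 := by
    have e : toQDivisor ((c : ℕ) • L - (b : ℕ) • M) =
        (c : ℕ) • toQDivisor L - (b : ℕ) • toQDivisor M := by
      change TensorProduct.mk ℤ ℚ (CartierDivisor X) 1 _ = _
      rw [map_sub, map_nsmul, map_nsmul]; rfl
    rw [e, ← hL, ← hM, smul_comm, sub_self]
  obtain ⟨n, hn⟩ := toQDivisor_eq_zero h
  rw [smul_sub, sub_eq_zero, smul_smul, smul_smul, ← PNat.mul_coe, ← PNat.mul_coe] at hn
  rw [← cartierStableLocus_nsmul L (n * c), hn, cartierStableLocus_nsmul]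

lemma stableLocus_eq {X : Scheme.{u}} [IsIntegral X] {D : QDivisor X} {b : ℕ+}
    {L : CartierDivisor X} (hL : (b : ℕ) • D = toQDivisor L) :
    stableLocus D = cartierStableLocus L := by
  apply le_antisymm
  · exact (iInf_le _ b).trans ((iInf_le _ L).trans (iInf_le _ hL))
  · exact le_iInf fun c => le_iInf fun M => le_iInf fun hM => (cartierStableLocus_congr hL hM).le

/-! ### Pullback of divisors -/

/-- The map `k(Z)ˣ / 𝒪_{Z, g(x)}ˣ → k(X)ˣ / 𝒪_{X, x}ˣ` induced by a dominant morphism. -/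
def cartierStalkMap {X Z : Scheme.{u}} [IsIntegral X] [IsIntegral Z] (g : X ⟶ Z)
    [IsDominant g] (x : X) : CartierStalk Z (g x) →+ CartierStalk X x :=
  MonoidHom.toAdditive (QuotientGroup.map (stalkUnits Z (g x)) (stalkUnits X x)
    (Units.map (functionFieldMap g).toMonoidHom) (by
      rintro _ ⟨a, rfl⟩
      exact ⟨Units.map (g.stalkMap x).hom.toMonoidHom a,
        Units.ext (functionFieldMap_algebraMap g x a).symm⟩))

/-- Pullback of Cartier divisors along a dominant morphism of integral schemes: local
equations are pulled back. -/
def pullbackDivisor {X Z : Scheme.{u}} [IsIntegral X] [IsIntegral Z] (g : X ⟶ Z)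
    [IsDominant g] : CartierDivisor Z →+ CartierDivisor X where
  toFun D := ⟨fun x => cartierStalkMap g x (D.1 (g x)), by
    intro x
    obtain ⟨U, hU, f, hf⟩ := D.2 (g x)
    refine ⟨g ⁻¹ᵁ U, hU, Units.map (functionFieldMap g).toMonoidHom f, fun y hy => ?_⟩
    exact (congrArg (cartierStalkMap g y) (hf (g y) hy)).trans rfl⟩
  map_zero' := Subtype.ext (funext fun x => map_zero (cartierStalkMap g x))
  map_add' D E := Subtype.ext (funext fun x => map_add (cartierStalkMap g x) _ _)

/-- Pullback of `ℚ`-divisors, the `ℚ`-linear extension of the pullback of Cartier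
divisors. -/
def pullbackQDivisor {X Z : Scheme.{u}} [IsIntegral X] [IsIntegral Z] (g : X ⟶ Z)
    [IsDominant g] : QDivisor Z →ₗ[ℤ] QDivisor X :=
  (pullbackDivisor g).toIntLinearMap.lTensor ℚ

/-! ### Absolute Frobenius and purely inseparable morphisms -/

/-- The Frobenius of a commutative ring in which the prime `p` is zero (the zero ring is
allowed). -/
def ringFrobenius (p : ℕ) [Fact p.Prime] (R : Type u) [CommRing R] (h : (p : R) = 0) :
    R →+* R where
  toFun a := a ^ p
  map_one' := one_pow p
  map_mul' a b := mul_pow a b p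
  map_zero' := zero_pow (Fact.out : p.Prime).ne_zero
  map_add' a b := by
    obtain ⟨r, hr⟩ := exists_add_pow_prime_eq (Fact.out : p.Prime) a b
    rw [hr, h]; ring

lemma natCast_section_eq_zero {X : Scheme.{u}} {p : ℕ} (h : (p : Γ(X, ⊤)) = 0) (U : X.Opens) :
    (p : Γ(X, U)) = 0 := by
  have := congrArg (X.presheaf.map (homOfLE (le_top : U ≤ ⊤)).op).hom h
  rwa [map_natCast, map_zero] at this

lemma natCast_eq_zero_of_field {k : Type u} [Field k] (p : ℕ) [CharP k p] {X : Scheme.{u}}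
    (s : X ⟶ Spec (.of k)) : (p : Γ(X, ⊤)) = 0 := by
  have h : (p : k) = 0 := CharP.cast_eq_zero k p
  have := congrArg ((Scheme.ΓSpecIso (.of k)).inv ≫ s.appTop).hom h
  rwa [map_natCast, map_zero] at this

/-- The action of Frobenius on the structure sheaf, `s ↦ s ^ p` on every open set. -/
def frobeniusSheafMap (p : ℕ) [Fact p.Prime] (X : Scheme.{u}) (h : (p : Γ(X, ⊤)) = 0) :
    X.presheaf ⟶ X.presheaf where
  app U := CommRingCat.ofHom
    (ringFrobenius p (X.presheaf.obj U) (natCast_section_eq_zero h U.unop))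
  naturality U V i := by
    ext a
    exact (map_pow (X.presheaf.map i).hom a p).symm

/-- Frobenius as a morphism of ringed spaces: the identity on the underlying space and
`s ↦ s ^ p` on functions. -/
def frobeniusPresheafedHom (p : ℕ) [Fact p.Prime] (X : Scheme.{u}) (h : (p : Γ(X, ⊤)) = 0) :
    X.toPresheafedSpace.Hom X.toPresheafedSpace where
  base := 𝟙 X.toPresheafedSpace.carrier
  c := frobeniusSheafMap p X h

lemma frobenius_stalkMap (p : ℕ) [Fact p.Prime] (X : Scheme.{u}) (h : (p : Γ(X, ⊤)) = 0)
    (x : X) (a : X.presheaf.stalk x) :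
    (PresheafedSpace.Hom.stalkMap (frobeniusPresheafedHom p X h) x).hom a = a ^ p := by
  obtain ⟨U, hxU, s, rfl⟩ := X.presheaf.exists_germ_eq a
  have := PresheafedSpace.stalkMap_germ_apply (frobeniusPresheafedHom p X h) U x hxU s
  refine Eq.trans this ?_
  exact map_pow (X.presheaf.germ U x hxU).hom s p

/-- The absolute Frobenius morphism of a scheme in characteristic `p`. -/
def absoluteFrobenius (p : ℕ) [Fact p.Prime] (X : Scheme.{u}) (h : (p : Γ(X, ⊤)) = 0) :
    X ⟶ X :=
  Scheme.Hom.mk (LocallyRingedSpace.Hom.mk (frobeniusPresheafedHom p X h) fun x => ⟨fun a ha => by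
    have e : (PresheafedSpace.Hom.stalkMap (frobeniusPresheafedHom p X h) x).hom a = a ^ p :=
      frobenius_stalkMap p X h x a
    rw [e] at ha
    exact (isUnit_pow_iff (Fact.out : p.Prime).ne_zero).mp ha⟩)

/-- A finite surjective morphism `g : X ⟶ Z` of integral schemes, not required to be a
morphism over a base, is purely inseparable if `k(X)` is a purely inseparable extension of
`k(Z)`. -/
structure IsPurelyInseparableMorphism {X Z : Scheme.{u}} [IsIntegral X] [IsIntegral Z]
    (g : X ⟶ Z) [IsDominant g] : Prop where
  finite : IsFinite g
  surjective : Surjective g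
  functionField :
    letI := (functionFieldMap g).toAlgebra
    IsPurelyInseparable Z.functionField X.functionField

/-- A purely inseparable morphism `g : X ⟶ Z` has height one if the absolute Frobenius of
`X` factors through `g`. -/
structure IsPurelyInseparableOfHeightOne (p : ℕ) [Fact p.Prime] {X Z : Scheme.{u}}
    [IsIntegral X] [IsIntegral Z] (hp : (p : Γ(X, ⊤)) = 0) (g : X ⟶ Z) [IsDominant g] :
    Prop extends IsPurelyInseparableMorphism g where
  exists_factor : ∃ h : Z ⟶ X, g ≫ h = absoluteFrobenius p X hp

end StableBase

end

/-!
Pulling back effective divisors along a dominant `g : X ⟶ Z` shows `𝐁(g^*D) ⊆ g⁻¹ 𝐁(D)`. For the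
other inclusion, if `g ≫ h` is a power `F_X ^ e` of the absolute Frobenius and `g` is surjective,
then `h ≫ g` also fixes every point and raises every rational function to the power `q = p ^ e`.
Thus `h^*g^*L = qL` for every Cartier divisor `L` on `Z`, so the first inclusion for `h` gives
`𝐁(L) = 𝐁(h^*g^*L) ⊆ h⁻¹ 𝐁(g^*L)`, whose preimage under `g` is `g⁻¹ 𝐁(L) ⊆ 𝐁(g^*L)`.
-/

namespace StableBase

variable {X Y Z : Scheme.{u}}

instance {p : ℕ} [Fact p.Prime] (hp : (p : Γ(X, ⊤)) = 0) :
    Surjective (absoluteFrobenius p X hp) :=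
  ⟨Function.surjective_id⟩

lemma reducedPreimage_vanishingIdeal (g : X ⟶ Z) (S : Closeds Z) :
    reducedPreimage g (Scheme.IdealSheafData.vanishingIdeal S) =
      Scheme.IdealSheafData.vanishingIdeal (S.preimage g.continuous) := by
  rw [reducedPreimage, ← Scheme.IdealSheafData.vanishingIdeal_support,
    Scheme.IdealSheafData.support_comap]
  rfl

variable [IsIntegral X] [IsIntegral Y] [IsIntegral Z]

section FunctionField

lemma functionFieldMap_comp (f : X ⟶ Y) (g : Y ⟶ Z) [IsDominant f] [IsDominant g]
    (a : Z.functionField) :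
    functionFieldMap (f ≫ g) a = functionFieldMap f (functionFieldMap g a) := by
  let x := genericPoint X
  have map_stalk (b : Z.presheaf.stalk (g (f x))) :
      functionFieldMap (f ≫ g) (algebraMap _ Z.functionField b) =
        functionFieldMap f (functionFieldMap g (algebraMap _ Z.functionField b)) := by
    rw [functionFieldMap_algebraMap g (f x), functionFieldMap_algebraMap f x]
    refine (functionFieldMap_algebraMap (f ≫ g) x b).trans ?_
    rw [Scheme.Hom.stalkMap_comp]
    rfl
  obtain ⟨b, c, -, rfl⟩ := IsFractionRing.div_surjective (A := Z.presheaf.stalk (g (f x))) a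
  simp only [map_div₀, map_stalk]

lemma functionFieldMap_id (a : X.functionField) : functionFieldMap (𝟙 X) a = a := by
  apply (functionFieldMap (𝟙 X)).injective
  rw [← functionFieldMap_comp]
  simp only [Category.comp_id]

lemma functionFieldMap_absoluteFrobenius {p : ℕ} [Fact p.Prime] (hp : (p : Γ(X, ⊤)) = 0)
    (a : X.functionField) :
    functionFieldMap (absoluteFrobenius p X hp) a = a ^ p := by
  let x := genericPoint X
  have map_stalk (b : X.presheaf.stalk (absoluteFrobenius p X hp x)) :
      functionFieldMap (absoluteFrobenius p X hp) (algebraMap _ X.functionField b) =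
        (algebraMap _ X.functionField b) ^ p := by
    refine (functionFieldMap_algebraMap _ x b).trans ?_
    exact (congrArg _ (frobenius_stalkMap p X hp x b)).trans (map_pow _ _ _)
  obtain ⟨b, c, -, rfl⟩ :=
    IsFractionRing.div_surjective (A := X.presheaf.stalk (absoluteFrobenius p X hp x)) a
  rw [map_div₀, map_stalk, map_stalk, div_pow]

end FunctionField

section PowerMorphism

/-- An endomorphism of an integral scheme is an `n`-th power morphism if it fixes every point and
acts on the function field by `a ↦ a ^ n`. These are the properties of the iterates of the
absolute Frobenius that determine the pullback of divisors. -/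
structure IsPowerMorphism (n : ℕ) (f : X ⟶ X) : Prop extends IsDominant f where
  apply_eq : ∀ x, f x = x
  functionFieldMap_eq_pow : ∀ a, functionFieldMap f a = a ^ n

lemma isPowerMorphism_id : IsPowerMorphism 1 (𝟙 X) where
  apply_eq _ := rfl
  functionFieldMap_eq_pow a := by rw [functionFieldMap_id, pow_one]

lemma isPowerMorphism_absoluteFrobenius {p : ℕ} [Fact p.Prime] (hp : (p : Γ(X, ⊤)) = 0) :
    IsPowerMorphism p (absoluteFrobenius p X hp) where
  apply_eq _ := rfl
  functionFieldMap_eq_pow := functionFieldMap_absoluteFrobenius hp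

namespace IsPowerMorphism

variable {m n : ℕ} {f : X ⟶ X}

lemma ne_zero (hf : IsPowerMorphism n f) : n ≠ 0 := by
  rintro rfl
  have := hf.toIsDominant
  simpa only [map_zero, pow_zero, zero_ne_one] using hf.functionFieldMap_eq_pow 0

lemma comp {f' : X ⟶ X} (hf : IsPowerMorphism m f) (hf' : IsPowerMorphism n f') :
    IsPowerMorphism (m * n) (f ≫ f') :=
  have := hf.toIsDominant
  have := hf'.toIsDominant
  { apply_eq := fun x => by rw [Scheme.Hom.comp_apply, hf.apply_eq, hf'.apply_eq]
    functionFieldMap_eq_pow := fun a => by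
      rw [functionFieldMap_comp, hf'.functionFieldMap_eq_pow, hf.functionFieldMap_eq_pow,
        ← pow_mul, mul_comm] }

lemma pow (hf : IsPowerMorphism n f) (e : ℕ) : IsPowerMorphism (n ^ e) (End.of f ^ e).asHom := by
  induction e with
  | zero => exact isPowerMorphism_id
  | succ e ih =>
    rw [pow_succ (End.of f), pow_succ' n]
    exact hf.comp ih

variable {g : X ⟶ Z} {h : Z ⟶ X} [Surjective g]

lemma swap (hgh : IsPowerMorphism n (g ≫ h)) : IsPowerMorphism n (h ≫ g) := by
  have := hgh.toIsDominant
  have : IsDominant h := .of_comp g h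
  refine { apply_eq := fun z => ?_, functionFieldMap_eq_pow := fun a => ?_ }
  · obtain ⟨x, rfl⟩ := g.surjective z
    exact congrArg g (hgh.apply_eq x)
  · apply (functionFieldMap g).injective
    rw [functionFieldMap_comp, ← functionFieldMap_comp g h, hgh.functionFieldMap_eq_pow, map_pow]

end IsPowerMorphism

end PowerMorphism

section PullbackDivisor

lemma exists_eq_localClass {x : X} (c : CartierStalk X x) : ∃ f, c = localClass x f :=
  (QuotientGroup.mk_surjective c).imp fun _ => Eq.symm

lemma pullbackDivisor_comp (f : X ⟶ Y) (g : Y ⟶ Z) [IsDominant f] [IsDominant g]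
    (D : CartierDivisor Z) :
    pullbackDivisor (f ≫ g) D = pullbackDivisor f (pullbackDivisor g D) := by
  refine Subtype.ext (funext fun x => ?_)
  obtain ⟨a, ha⟩ := exists_eq_localClass (D.1 (g (f x)))
  change cartierStalkMap (f ≫ g) x (D.1 (g (f x))) =
    cartierStalkMap f x (cartierStalkMap g (f x) (D.1 (g (f x))))
  rw [ha]
  exact congrArg (localClass x) (Units.ext (functionFieldMap_comp f g a))

lemma IsPowerMorphism.pullbackDivisor_eq_nsmul {n : ℕ} {f : X ⟶ X} (hf : IsPowerMorphism n f)
    (D : CartierDivisor X) :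
    haveI := hf.toIsDominant
    pullbackDivisor f D = n • D := by
  have := hf.toIsDominant
  refine Subtype.ext (funext fun x => ?_)
  obtain ⟨U, hxU, a, ha⟩ := D.2 x
  change cartierStalkMap f x (D.1 (f x)) = n • D.1 x
  rw [ha x hxU, ha (f x) (by rwa [hf.apply_eq])]
  exact congrArg (localClass x) (Units.ext (hf.functionFieldMap_eq_pow a))

variable (g : X ⟶ Z) [IsDominant g]

lemma LinEquiv.pullbackDivisor {D E : CartierDivisor Z} (h : LinEquiv D E) :
    LinEquiv (pullbackDivisor g D) (pullbackDivisor g E) := by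
  obtain ⟨f, hf⟩ := h
  exact ⟨Units.map (functionFieldMap g).toMonoidHom f, by rw [← map_sub, hf]; rfl⟩

lemma mem_range_algebraMap_of_localClass_eq {x : X} {e f : (X.functionField)ˣ}
    (h : localClass x e = localClass x f)
    (he : (e : X.functionField) ∈ (algebraMap (X.presheaf.stalk x) X.functionField).range) :
    (f : X.functionField) ∈ (algebraMap (X.presheaf.stalk x) X.functionField).range := by
  obtain ⟨v, hv⟩ : e⁻¹ * f ∈ stalkUnits X x := QuotientGroup.eq.mp h
  rw [← mul_inv_cancel_left e f, ← hv, Units.val_mul]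
  exact mul_mem he ⟨v, rfl⟩

lemma IsEffective.pullbackDivisor {E : CartierDivisor Z} (hE : IsEffective E) :
    IsEffective (pullbackDivisor g E) := by
  intro x f hf
  obtain ⟨e, he⟩ := exists_eq_localClass (E.1 (g x))
  obtain ⟨a, ha⟩ := hE (g x) e he
  have hef : localClass x (Units.map (functionFieldMap g).toMonoidHom e) = localClass x f :=
    (congrArg (cartierStalkMap g x) he).symm.trans hf
  refine mem_range_algebraMap_of_localClass_eq hef ⟨g.stalkMap x a, ?_⟩
  exact (functionFieldMap_algebraMap g x a).symm.trans (congrArg (functionFieldMap g) ha)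

lemma pullbackDivisor_mem_linearSystem {E L : CartierDivisor Z} (hE : E ∈ linearSystem L) :
    pullbackDivisor g E ∈ linearSystem (pullbackDivisor g L) :=
  ⟨hE.1.pullbackDivisor g, hE.2.pullbackDivisor g⟩

end PullbackDivisor

section BaseLocus

lemma support_pullbackDivisor_le (g : X ⟶ Z) [IsDominant g] (E : CartierDivisor Z) :
    support (pullbackDivisor g E) ≤ (support E).preimage g.continuous := fun x hx h0 =>
  hx ((congrArg (cartierStalkMap g x) h0).trans (map_zero _))

lemma mem_baseLocus {L : CartierDivisor X} {x : X} :
    x ∈ baseLocus L ↔ ∀ E ∈ linearSystem L, x ∈ support E := by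
  simp only [baseLocus, Closeds.mem_iInf]

lemma mem_cartierStableLocus {L : CartierDivisor X} {x : X} :
    x ∈ cartierStableLocus L ↔ ∀ m : ℕ+, x ∈ baseLocus ((m : ℕ) • L) :=
  Closeds.mem_iInf

lemma baseLocus_pullbackDivisor_le (g : X ⟶ Z) [IsDominant g] (L : CartierDivisor Z) :
    baseLocus (pullbackDivisor g L) ≤ (baseLocus L).preimage g.continuous := fun _ hx =>
  mem_baseLocus.mpr fun E hE => support_pullbackDivisor_le g E
    (mem_baseLocus.mp hx _ (pullbackDivisor_mem_linearSystem g hE))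

lemma cartierStableLocus_pullbackDivisor_le (g : X ⟶ Z) [IsDominant g] (L : CartierDivisor Z) :
    cartierStableLocus (pullbackDivisor g L) ≤
      (cartierStableLocus L).preimage g.continuous := fun _ hx =>
  mem_cartierStableLocus.mpr fun m => baseLocus_pullbackDivisor_le g _ <| by
    rw [map_nsmul]
    exact mem_cartierStableLocus.mp hx m

variable {g : X ⟶ Z} {h : Z ⟶ X} [Surjective g] {n : ℕ}

lemma cartierStableLocus_pullbackDivisor (hgh : IsPowerMorphism n (g ≫ h))
    (L : CartierDivisor Z) :
    cartierStableLocus (pullbackDivisor g L) =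
      (cartierStableLocus L).preimage g.continuous := by
  have := hgh.toIsDominant
  have : IsDominant h := .of_comp g h
  have hL : cartierStableLocus L =
      cartierStableLocus (pullbackDivisor h (pullbackDivisor g L)) := by
    rw [← pullbackDivisor_comp, hgh.swap.pullbackDivisor_eq_nsmul]
    exact (cartierStableLocus_nsmul L ⟨n, Nat.pos_of_ne_zero hgh.ne_zero⟩).symm
  refine le_antisymm (cartierStableLocus_pullbackDivisor_le g L) fun x hx => ?_
  have hhgx : h (g x) ∈ cartierStableLocus (pullbackDivisor g L) :=
    cartierStableLocus_pullbackDivisor_le h _ (hL ▸ hx)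
  rwa [← Scheme.Hom.comp_apply, hgh.apply_eq] at hhgx

lemma stableLocus_pullbackQDivisor (hgh : IsPowerMorphism n (g ≫ h)) (D : QDivisor Z) :
    stableLocus (pullbackQDivisor g D) = (stableLocus D).preimage g.continuous := by
  obtain ⟨b, L, hL⟩ := exists_cartier_multiple D
  have hgL : (b : ℕ) • pullbackQDivisor g D = toQDivisor (pullbackDivisor g L) := by
    rw [← map_nsmul, hL]
    rfl
  rw [stableLocus_eq hL, stableLocus_eq hgL, cartierStableLocus_pullbackDivisor hgh]

end BaseLocus

end StableBase

theorem lemma4p4_general {p : ℕ} [Fact p.Prime] {X Z : Scheme.{u}} [IsIntegral X] [IsIntegral Z]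
    (hp : (p : Γ(X, ⊤)) = 0) (g : X ⟶ Z) [Surjective g] {h : Z ⟶ X} {e : ℕ}
    (hgh : g ≫ h = (End.of (StableBase.absoluteFrobenius p X hp) ^ e).asHom)
    (D : StableBase.QDivisor Z) :
    StableBase.stableBaseLocus (StableBase.pullbackQDivisor g D) =
      StableBase.reducedPreimage g (StableBase.stableBaseLocus D) := by
  have hpow : StableBase.IsPowerMorphism (p ^ e) (g ≫ h) :=
    hgh ▸ (StableBase.isPowerMorphism_absoluteFrobenius hp).pow e
  rw [StableBase.stableBaseLocus, StableBase.stableBaseLocus,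
    StableBase.reducedPreimage_vanishingIdeal, StableBase.stableLocus_pullbackQDivisor hpow]

theorem lemma4p4 {k : Type u} [Field k] [PerfectField k] (p : ℕ) [Fact p.Prime] [CharP k p]
    {X Z : Scheme.{u}} (sX : X ⟶ Spec (.of k)) (sZ : Z ⟶ Spec (.of k))
    [IsIntegral X] [IsSeparated sX] [LocallyOfFiniteType sX] [QuasiCompact sX]
    [IsIntegral Z] [IsSeparated sZ] [LocallyOfFiniteType sZ] [QuasiCompact sZ]
    (hX : StableBase.IsNormalScheme X) (hZ : StableBase.IsNormalScheme Z)
    (g : X ⟶ Z) [IsFinite g] [Surjective g]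
    (hg : StableBase.IsPurelyInseparableOfHeightOne p
      (StableBase.natCast_eq_zero_of_field p sX) g)
    (D : StableBase.QDivisor Z) :
    StableBase.stableBaseLocus (StableBase.pullbackQDivisor g D) =
      StableBase.reducedPreimage g (StableBase.stableBaseLocus D) := by
  obtain ⟨h, hgh⟩ := hg.exists_factor
  exact lemma4p4_general _ g (hgh.trans (pow_one (End.of _)).symm) D
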